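/- Let $E$ be a real Banach space with topological dual $E'$; equip $E'$ with the weak-* topology and its Borel $\sigma$-field. Let $(S,\sigma)$ be a finite measure space, $0<\alpha<2$, and let $\varphi:S\to E'$ be measurable with $\|\varphi(s)\|_{E'}\le 1$ for all $s\in S$ and such that the image measure $\sigma\circ\varphi^{-1}$ is a Radon measure on $E'$ (i.e. inner regular with respect to weak-* compact sets; this is automatic if $E$ is separable). Let $u:E\to L_\alpha(S,\sigma)$ be the operator decomposed by $\varphi$, i.e. $(uz)(s)=\langle z,\varphi(s)\rangle$ for $\sigma$-a.e. $s$, for every $z\in E$, and let $u_\infty:E\to L_\infty(S,\sigma)$ be the same operator regarded as a bounded operator into $L_\infty(S,\sigma)$. On a probability space $(\Delta,\mathbb{Q})$ let $(V_j)_{j\ge1}$ be i.i.d. $S$-valued random variables with distribution $\sigma/\sigma(S)$ and let $(\zeta_j)_{j\ge1}$ be i.i.d. standard exponential random variables, the two sequences being independent of each other. Put $\Gamma_j:=\zeta_1+\dots+\zeta_j$ and $$c_\alpha:=\sqrt2\left(\int_0^\infty x^{-\alpha}\sin x\,dx\right)^{-1/\alpha}\bigl(\mathbf{E}|\xi|^\alpha\bigr)^{-1/\alpha},$$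 where $\xi$ is standard normal and the first integral is the improper one, $\lim_{T\to\infty}\int_0^T x^{-\alpha}\sin x\,dx$. For a bounded linear operator $T:E\to F$ between normed spaces and $n\ge1$, let $$e_n(T):=\inf\bigl\{\varepsilon>0:\ \exists\,y_1,\dots,y_{2^{n-1}}\in F\ \ \forall z\in E,\ \|z\|\le1,\ \exists\, i\le 2^{n-1}:\ \|Tz-y_i\|\le\varepsilon\bigr\}.$$ Then $\mathbb{Q}$-almost surely the formulas $$w(z)=\bigl(\langle z,\varphi(V_j)\rangle\bigr)_{j\ge1},\quad z\in E,\qquad D(y)=c_\alpha\,\sigma(S)^{1/\alpha}\bigl(\Gamma_j^{-1/\alpha}y_j\bigr)_{j\ge1},\quad y\in\ell_\infty,$$ define bounded linear operators $w:E\to\ell_\infty$ and $D:\ell_\infty\to\ell_2$, and the random operator $v:=D\circ w:E\to\ell_2$ satisfies $$\limsup_{n\to\infty}\ n^{1/\alpha-1/2}\,\frac{e_{2n-1}(v)}{e_n(u_\infty)}<\infty ,$$ where $0/0:=0$ and $a/0:=\infty$ for $a>0$. -/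

import Mathlib

open MeasureTheory ProbabilityTheory Filter Topology
open scoped ENNReal

noncomputable section

namespace StableEntropy

/-- The topological dual `E'` with its weak-* topology carries the corresponding Borel
σ-field. -/
instance instMeasurableSpaceWeakDual {E : Type*} [NormedAddCommGroup E] [NormedSpace ℝ E] :
    MeasurableSpace (WeakDual ℝ E) := borel _

instance instBorelSpaceWeakDual {E : Type*} [NormedAddCommGroup E] [NormedSpace ℝ E] :
    BorelSpace (WeakDual ℝ E) := ⟨rfl⟩

/-- The `n`-th dyadic entropy number (`n ≥ 1`) of a bounded linear operator `T : E → F`: the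
infimum of all `ε > 0` such that the image of the closed unit ball of `E` is covered by
`2 ^ (n - 1)` closed balls of radius `ε` with centres in `F`. The set is never empty, as
`T` is bounded. -/
def entropyNumber {E F : Type*} [NormedAddCommGroup E] [NormedSpace ℝ E]
    [NormedAddCommGroup F] [NormedSpace ℝ F] (T : E →L[ℝ] F) (n : ℕ) : ℝ :=
  sInf {ε : ℝ | 0 < ε ∧ ∃ y : Fin (2 ^ (n - 1)) → F,
    ∀ z : E, ‖z‖ ≤ 1 → ∃ i, ‖T z - y i‖ ≤ ε}

/-- The improper integral `∫₀^∞ x ^ (-α) sin x dx = lim_{T → ∞} ∫₀^T x ^ (-α) sin x dx`. The limit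
exists for `0 < α < 2`, but for `α ≤ 1` the integrand is not absolutely integrable. -/
def sineIntegral (α : ℝ) : ℝ :=
  limUnder atTop fun T : ℝ => ∫ x in (0 : ℝ)..T, x ^ (-α) * Real.sin x

/-- The constant `c_α = √2 (∫₀^∞ x ^ (-α) sin x dx) ^ (-1/α) (𝔼 |ξ| ^ α) ^ (-1/α)`, where `ξ` is a
standard normal random variable. -/
def stableConst (α : ℝ) : ℝ :=
  √2 * sineIntegral α ^ (-1 / α) * (∫ x, |x| ^ α ∂(gaussianReal 0 1)) ^ (-1 / α)

/-- The arrival times `Γ_j = ζ_1 + ⋯ + ζ_j`; sequences are indexed from `0` here, so that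
`arrival ζ j δ` is `Γ_{j+1}(δ)`. -/
def arrival {Δ : Type*} (ζ : ℕ → Δ → ℝ) (j : ℕ) (δ : Δ) : ℝ :=
  ∑ i ∈ Finset.range (j + 1), ζ i δ

/-- `w : E → ℓ_∞` is the sampling operator `z ↦ (⟨z, φ(s_j)⟩)_j` at the points `s_j`. -/
def IsSamplingOperator {E S : Type*} [NormedAddCommGroup E] [NormedSpace ℝ E]
    (φ : S → WeakDual ℝ E) (s : ℕ → S) (w : E →L[ℝ] lp (fun _ : ℕ => ℝ) ∞) : Prop :=
  ∀ (z : E) (j : ℕ), w z j = φ (s j) z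

/-- `D : ℓ_∞ → ℓ_2` is the diagonal operator `y ↦ (d_j y_j)_j`. -/
def IsDiagonalOperator (d : ℕ → ℝ)
    (D : lp (fun _ : ℕ => ℝ) ∞ →L[ℝ] lp (fun _ : ℕ => ℝ) 2) : Prop :=
  ∀ (y : lp (fun _ : ℕ => ℝ) ∞) (j : ℕ), D y j = d j * y j

end StableEntropy

end

/-!
The proof compares `v = D ∘ w` with `u_∞` through three facts, the first two of them valid for
almost every outcome.

* The operator `w` is dominated by `u_∞`: `‖w z‖ ≤ ‖u_∞ z‖` for all `z` at once. For fixed `z` this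
  holds off a null set by the definition of the essential supremum. The sets
  `{x' : |⟨z, x'⟩| > ‖u_∞ z‖}` are weak-* open and null for the law of `φ`, and since that law is
  inner regular their union over all `z` is null too (`measure_iUnion_null_of_isOpen`,
  `ae_forall_abs_le_norm`). So no separability of `E` is needed.
* The strong law of large numbers gives `Γ_j ≥ c j` for large `j`, hence the entries of `D` are
  `O(j ^ (-1 / α))` (`ae_eventually_mul_le_arrival`, `exists_abs_mul_rpow_le`). The exact values of
  the constants `c_α` and `σ(S)` play no role.
* A diagonal operator `ℓ_∞ → ℓ_2` with entries `O(j ^ (-a))`, `a > 1 / 2`, has entropy numbers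
  `O(n ^ (1 / 2 - a))` (`exists_entropyNumber_diagonal_le`). Quantize the first `m` coordinates with
  step `m ^ (-a)` and drop the others: the error is `O(m ^ (1 / 2 - a))`, and the number of cells is
  at most `∏_{j ≤ m} O((m / j) ^ a) = 2 ^ O(m)`.

Since entropy numbers are multiplicative up to a factor `2` when centres are moved into the range
(`entropyNumber_comp_le_of_norm_le`), it follows that
`e_{2n-1}(v) ≤ 2 e_n(D) e_n(u_∞) = O(n ^ (1 / 2 - 1 / α)) e_n(u_∞)`, which also settles the case
`e_n(u_∞) = 0`.
-/

namespace StableEntropy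

/-! ### Entropy numbers -/

section Entropy

variable {E F G H : Type*} [NormedAddCommGroup E] [NormedSpace ℝ E]
  [NormedAddCommGroup F] [NormedSpace ℝ F] [NormedAddCommGroup G] [NormedSpace ℝ G]
  [NormedAddCommGroup H] [NormedSpace ℝ H]

lemma entropyNumber_nonneg (T : E →L[ℝ] F) (n : ℕ) : 0 ≤ entropyNumber T n :=
  Real.sInf_nonneg fun _ h => h.1.le

lemma entropyNumber_le_of_cover (T : E →L[ℝ] F) (n : ℕ) {ι : Type*} [Fintype ι]
    (hι : Fintype.card ι ≤ 2 ^ (n - 1)) {ε : ℝ} (hε : 0 < ε) (y : ι → F)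
    (hy : ∀ z : E, ‖z‖ ≤ 1 → ∃ i, ‖T z - y i‖ ≤ ε) : entropyNumber T n ≤ ε := by
  refine csInf_le ⟨0, fun _ h => h.1.le⟩ ⟨hε, ?_⟩
  obtain ⟨i₀, -⟩ := hy 0 (by simp)
  have hcard : Fintype.card ι ≤ Fintype.card (Fin (2 ^ (n - 1))) := by simpa using hι
  obtain ⟨f⟩ := Function.Embedding.nonempty_of_card_le hcard
  have : Nonempty ι := ⟨i₀⟩
  refine ⟨fun k => y (Function.invFun f k), fun z hz => ?_⟩
  obtain ⟨i, hi⟩ := hy z hz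
  exact ⟨f i, by simpa only [Function.leftInverse_invFun f.injective i] using hi⟩

lemma exists_cover_of_entropyNumber_lt (T : E →L[ℝ] F) (n : ℕ) {ε : ℝ}
    (h : entropyNumber T n < ε) :
    ∃ y : Fin (2 ^ (n - 1)) → F, ∀ z : E, ‖z‖ ≤ 1 → ∃ i, ‖T z - y i‖ ≤ ε := by
  have hne : {ε : ℝ | 0 < ε ∧ ∃ y : Fin (2 ^ (n - 1)) → F,
      ∀ z : E, ‖z‖ ≤ 1 → ∃ i, ‖T z - y i‖ ≤ ε}.Nonempty := by
    refine ⟨‖T‖ + 1, by positivity, fun _ => 0, fun z hz => ⟨0, ?_⟩⟩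
    have := T.le_opNorm_of_le hz
    simp only [sub_zero]
    linarith
  obtain ⟨ε', ⟨-, y, hy⟩, hlt⟩ := exists_lt_of_csInf_lt hne h
  refine ⟨y, fun z hz => ?_⟩
  obtain ⟨i, hi⟩ := hy z hz
  exact ⟨i, hi.trans hlt.le⟩

/-- Multiplicativity of entropy numbers, for a factor `w` that is only dominated by `T`. The centres
covering the image of `T` need not lie in its range, and moving them there costs the factor `2`. -/
lemma entropyNumber_comp_le_of_norm_le (T : E →L[ℝ] H) (w : E →L[ℝ] F) (D : F →L[ℝ] G)
    (hw : ∀ z, ‖w z‖ ≤ ‖T z‖) {n : ℕ} (hn : 1 ≤ n) :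
    entropyNumber (D ∘L w) (2 * n - 1) ≤ 2 * entropyNumber D n * entropyNumber T n := by
  have key : ∀ t : ℝ, 0 < t → entropyNumber (D ∘L w) (2 * n - 1) ≤
      2 * (entropyNumber D n + t) * (entropyNumber T n + t) := by
    intro t ht
    have hD0 := entropyNumber_nonneg D n
    have hT0 := entropyNumber_nonneg T n
    obtain ⟨x, hx⟩ := exists_cover_of_entropyNumber_lt D n (lt_add_of_pos_right _ ht)
    obtain ⟨y, hy⟩ := exists_cover_of_entropyNumber_lt T n (lt_add_of_pos_right _ ht)
    set η := entropyNumber D n + t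
    set ε := entropyNumber T n + t
    have hη : 0 < η := by positivity
    have hε : 0 < ε := by positivity
    have hz : ∀ i, ∃ z₀ : E, ∀ z, ‖z‖ ≤ 1 → ‖T z - y i‖ ≤ ε → ‖T z₀ - y i‖ ≤ ε := by
      intro i
      by_cases h : ∃ z, ‖z‖ ≤ 1 ∧ ‖T z - y i‖ ≤ ε
      · obtain ⟨z₀, -, h₀⟩ := h
        exact ⟨z₀, fun _ _ _ => h₀⟩
      · exact ⟨0, fun z h1 h2 => absurd ⟨z, h1, h2⟩ h⟩
    choose z₀ hz₀ using hz
    refine entropyNumber_le_of_cover (D ∘L w) (2 * n - 1)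
      (ι := Fin (2 ^ (n - 1)) × Fin (2 ^ (n - 1))) ?_ (by positivity)
      (fun p => D (w (z₀ p.1)) + (2 * ε) • x p.2) fun z hz1 => ?_
    · rw [Fintype.card_prod, Fintype.card_fin, ← pow_add]
      exact Nat.pow_le_pow_right two_pos (by omega)
    obtain ⟨i, hi⟩ := hy z hz1
    have h1 : ‖w (z - z₀ i)‖ ≤ 2 * ε := by
      refine (hw _).trans ?_
      have h2 := hz₀ i z hz1 hi
      have h3 : T (z - z₀ i) = (T z - y i) - (T (z₀ i) - y i) := by simp
      rw [h3]
      exact (norm_sub_le _ _).trans (by linarith)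
    obtain ⟨k, hk⟩ := hx ((2 * ε)⁻¹ • w (z - z₀ i)) (by
      rw [norm_smul, Real.norm_of_nonneg (by positivity), inv_mul_le_iff₀ (by positivity)]
      simpa using h1)
    refine ⟨(i, k), ?_⟩
    have h4 : (D ∘L w) z - (D (w (z₀ i)) + (2 * ε) • x k) =
        (2 * ε) • (D ((2 * ε)⁻¹ • w (z - z₀ i)) - x k) := by
      rw [map_smul, smul_sub, smul_inv_smul₀ (by positivity)]
      simp only [ContinuousLinearMap.comp_apply, map_sub]
      abel
    rw [h4, norm_smul, Real.norm_of_nonneg (by positivity)]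
    calc 2 * ε * _ ≤ 2 * ε * η := by gcongr
      _ = 2 * η * ε := by ring
  have hcont : Tendsto (fun t : ℝ => 2 * (entropyNumber D n + t) * (entropyNumber T n + t))
      (𝓝[>] 0) (𝓝 (2 * entropyNumber D n * entropyNumber T n)) := by
    have : Continuous fun t : ℝ => 2 * (entropyNumber D n + t) * (entropyNumber T n + t) := by
      fun_prop
    simpa using (this.tendsto 0).mono_left nhdsWithin_le_nhds
  exact ge_of_tendsto hcont (eventually_mem_nhdsWithin.mono key)

end Entropy

/-! ### Diagonal operators from `ℓ_∞` to `ℓ_2` -/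

/-- The tail of the `p`-series, bounded by telescoping. -/
lemma sum_Ico_rpow_neg_le {p : ℝ} (hp : 1 < p) {m N : ℕ} (hm : 1 ≤ m) (hN : m ≤ N) :
    ∑ j ∈ Finset.Ico m N, ((j : ℝ) + 1) ^ (-p) ≤ (m : ℝ) ^ (1 - p) / (p - 1) := by
  have hp1 : 0 < p - 1 := by linarith
  have step : ∀ j : ℕ, 1 ≤ j → (p - 1) * ((j : ℝ) + 1) ^ (-p) ≤
      (j : ℝ) ^ (1 - p) - ((j : ℝ) + 1) ^ (1 - p) := by
    intro j hj
    have hj0 : (0 : ℝ) < j := by exact_mod_cast hj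
    have hj1 : (0 : ℝ) < (j : ℝ) + 1 := by positivity
    have hexp : (j : ℝ) / (j + 1) ≤ Real.exp (-(1 / ((j : ℝ) + 1))) := by
      have := Real.add_one_le_exp (-(1 / ((j : ℝ) + 1)))
      have h2 : (j : ℝ) / (j + 1) = -(1 / ((j : ℝ) + 1)) + 1 := by field_simp; ring
      rwa [h2]
    -- Bernoulli's inequality for the exponent `1 - p < 0` and the base `1 - 1 / (j + 1)`
    have hb : 1 + (p - 1) / ((j : ℝ) + 1) ≤ ((j : ℝ) / (j + 1)) ^ (1 - p) := by
      calc 1 + (p - 1) / ((j : ℝ) + 1) ≤ Real.exp ((p - 1) / ((j : ℝ) + 1)) := by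
            rw [add_comm]; exact Real.add_one_le_exp _
        _ = Real.exp (-(1 / ((j : ℝ) + 1))) ^ (1 - p) := by
            rw [← Real.exp_mul]; congr 1; field_simp; ring
        _ ≤ ((j : ℝ) / (j + 1)) ^ (1 - p) :=
            Real.rpow_le_rpow_of_nonpos (by positivity) hexp (by linarith)
    rw [Real.div_rpow hj0.le hj1.le, le_div_iff₀ (by positivity)] at hb
    have h3 : ((j : ℝ) + 1) ^ (-p) = ((j : ℝ) + 1) ^ (1 - p) / (j + 1) := by
      rw [eq_div_iff hj1.ne', ← Real.rpow_add_one hj1.ne']; congr 1; ring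
    rw [h3]
    calc _ = (1 + (p - 1) / ((j : ℝ) + 1)) * ((j : ℝ) + 1) ^ (1 - p)
          - ((j : ℝ) + 1) ^ (1 - p) := by ring
      _ ≤ _ := by linarith
  rw [le_div_iff₀ hp1, mul_comm, Finset.mul_sum]
  calc _ ≤ ∑ j ∈ Finset.Ico m N, ((j : ℝ) ^ (1 - p) - ((j + 1 : ℕ) : ℝ) ^ (1 - p)) := by
        refine Finset.sum_le_sum fun j hj => ?_
        push_cast
        exact step j (hm.trans (Finset.mem_Ico.1 hj).1)
    _ = (m : ℝ) ^ (1 - p) - (N : ℝ) ^ (1 - p) := by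
        have := Finset.sum_Ico_sub (fun j : ℕ => -(j : ℝ) ^ (1 - p)) hN
        simp only [neg_sub_neg] at this
        rw [this]
    _ ≤ _ := by linarith [Real.rpow_nonneg (Nat.cast_nonneg N) (1 - p)]

/-- A sequence that is of size `A m ^ (-a)` on its first `m` coordinates and `A j ^ (-a)` on the
`j`-th of the others has `ℓ_2`-norm at most a multiple of `A m ^ (1 / 2 - a)`. -/
lemma sum_sq_le_of_abs_le {a A : ℝ} (ha : 1 / 2 < a) {m : ℕ} (hm : 1 ≤ m)
    {f : ℕ → ℝ} (h1 : ∀ j < m, |f j| ≤ A * (m : ℝ) ^ (-a))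
    (h2 : ∀ j, m ≤ j → |f j| ≤ A * ((j : ℝ) + 1) ^ (-a)) (s : Finset ℕ) :
    ∑ j ∈ s, |f j| ^ 2 ≤ (A * √(1 + 1 / (2 * a - 1)) * (m : ℝ) ^ (1 / 2 - a)) ^ 2 := by
  have hm0 : (0 : ℝ) < m := by exact_mod_cast hm
  have hsq : ∀ x : ℝ, 0 ≤ x → (A * x ^ (-a)) ^ 2 = A ^ 2 * x ^ (-(2 * a)) := by
    intro x hx
    rw [mul_pow, ← Real.rpow_natCast (x ^ (-a)), ← Real.rpow_mul hx]
    congr 2; push_cast; ring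
  set N := max m (s.sup id + 1)
  have hs : s ⊆ Finset.range N := fun j hj =>
    Finset.mem_range.2 (lt_max_of_lt_right (Nat.lt_succ_of_le (Finset.le_sup (f := id) hj)))
  have hmN : m ≤ N := le_max_left _ _
  have e1 : ∑ j ∈ Finset.range m, |f j| ^ 2 ≤ A ^ 2 * (m : ℝ) ^ (1 - 2 * a) := by
    calc _ ≤ ∑ j ∈ Finset.range m, A ^ 2 * (m : ℝ) ^ (-(2 * a)) := by
          refine Finset.sum_le_sum fun j hj => ?_
          rw [← hsq _ hm0.le]
          exact pow_le_pow_left₀ (abs_nonneg _) (h1 j (Finset.mem_range.1 hj)) 2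
      _ = _ := by
          rw [Finset.sum_const, Finset.card_range, nsmul_eq_mul,
            show 1 - 2 * a = -(2 * a) + 1 by ring, Real.rpow_add_one hm0.ne']
          ring
  have e2 : ∑ j ∈ Finset.Ico m N, |f j| ^ 2 ≤ A ^ 2 * ((m : ℝ) ^ (1 - 2 * a) / (2 * a - 1)) := by
    calc _ ≤ ∑ j ∈ Finset.Ico m N, A ^ 2 * ((j : ℝ) + 1) ^ (-(2 * a)) := by
          refine Finset.sum_le_sum fun j hj => ?_
          rw [← hsq _ (by positivity)]
          exact pow_le_pow_left₀ (abs_nonneg _) (h2 j (Finset.mem_Ico.1 hj).1) 2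
      _ ≤ _ := by
          rw [← Finset.mul_sum]
          gcongr
          exact sum_Ico_rpow_neg_le (by linarith) hm hmN
  calc ∑ j ∈ s, |f j| ^ 2 ≤ ∑ j ∈ Finset.range N, |f j| ^ 2 :=
        Finset.sum_le_sum_of_subset_of_nonneg hs fun _ _ _ => by positivity
    _ = ∑ j ∈ Finset.range m, |f j| ^ 2 + ∑ j ∈ Finset.Ico m N, |f j| ^ 2 :=
        (Finset.sum_range_add_sum_Ico _ hmN).symm
    _ ≤ A ^ 2 * (m : ℝ) ^ (1 - 2 * a) + A ^ 2 * ((m : ℝ) ^ (1 - 2 * a) / (2 * a - 1)) :=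
        add_le_add e1 e2
    _ = _ := by
        have hpos : 0 < 2 * a - 1 := by linarith
        rw [mul_pow, mul_pow, Real.sq_sqrt (by positivity), ← Real.rpow_natCast (_ ^ (1 / 2 - a)),
          ← Real.rpow_mul hm0.le,
          show (1 / 2 - a) * ((2 : ℕ) : ℝ) = 1 - 2 * a by push_cast; ring]
        ring

lemma memℓp_two_of_sum_sq_le {f : ℕ → ℝ} {C : ℝ} (h : ∀ s : Finset ℕ, ∑ j ∈ s, |f j| ^ 2 ≤ C) :
    Memℓp f 2 :=
  memℓp_gen' (C := C) fun s => by simpa using h s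

lemma norm_lp_two_le {f : lp (fun _ : ℕ => ℝ) 2} {C : ℝ} (hC : 0 ≤ C)
    (h : ∀ s : Finset ℕ, ∑ j ∈ s, |f j| ^ 2 ≤ C ^ 2) : ‖f‖ ≤ C :=
  lp.norm_le_of_forall_sum_le (by simp) hC fun s => by simpa using h s

/-- Quantizing the `j`-th coordinate into `O((m / j) ^ a)` levels, for `j ≤ m`, takes altogether
`2 ^ O(m)` points, because `m ^ m / m! ≤ e ^ m`. -/
lemma prod_levels_le {a : ℝ} (ha : 0 ≤ a) (m : ℕ) :
    ∏ j : Fin m, (2 * ⌈((m : ℝ) / ((j : ℕ) + 1)) ^ a⌉₊ + 1) ≤ 2 ^ ((3 + ⌈2 * a⌉₊) * m) := by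
  -- as `m / j ≥ 1`, the rounding costs a constant factor `8` only
  have h1 : ∀ j : Fin m, ((2 * ⌈((m : ℝ) / ((j : ℕ) + 1)) ^ a⌉₊ + 1 : ℕ) : ℝ) ≤
      8 * ((m : ℝ) / ((j : ℕ) + 1)) ^ a := by
    intro j
    have hx : (1 : ℝ) ≤ ((m : ℝ) / ((j : ℕ) + 1)) ^ a := by
      refine Real.one_le_rpow ?_ ha
      rw [one_le_div (by positivity)]
      exact_mod_cast j.2
    have := Nat.ceil_lt_add_one (zero_le_one.trans hx)
    push_cast
    linarith
  have h2 : ∏ j : Fin m, (m : ℝ) / ((j : ℕ) + 1) = (m : ℝ) ^ m / (m.factorial : ℝ) := by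
    rw [Finset.prod_div_distrib, Finset.prod_const, Finset.card_univ, Fintype.card_fin,
      Fin.prod_univ_eq_prod_range (fun j => (j : ℝ) + 1) m, ← Finset.prod_range_add_one_eq_factorial]
    push_cast
    rfl
  have h3 : (∏ j : Fin m, (m : ℝ) / ((j : ℕ) + 1)) ^ a ≤ (2 : ℝ) ^ (⌈2 * a⌉₊ * m) := by
    have he : Real.exp 1 ≤ 2 ^ (2 : ℝ) := by
      have := Real.exp_one_lt_d9
      norm_num
      linarith
    calc _ ≤ Real.exp m ^ a := by
          rw [h2]
          exact Real.rpow_le_rpow (by positivity)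
            (Real.pow_div_factorial_le_exp (m : ℝ) (Nat.cast_nonneg m) m) ha
      _ = Real.exp 1 ^ (m * a) := by rw [← Real.exp_mul, ← Real.exp_mul, one_mul]
      _ ≤ ((2 : ℝ) ^ (2 : ℝ)) ^ (m * a) :=
          Real.rpow_le_rpow (Real.exp_pos _).le he (by positivity)
      _ = (2 : ℝ) ^ (2 * a * m) := by rw [← Real.rpow_mul zero_le_two]; congr 1; ring
      _ ≤ (2 : ℝ) ^ (((⌈2 * a⌉₊ * m : ℕ) : ℝ)) := by
          refine Real.rpow_le_rpow_of_exponent_le one_le_two ?_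
          push_cast
          gcongr
          exact Nat.le_ceil _
      _ = _ := Real.rpow_natCast _ _
  have h4 : ((∏ j : Fin m, (2 * ⌈((m : ℝ) / ((j : ℕ) + 1)) ^ a⌉₊ + 1) : ℕ) : ℝ) ≤
      ((2 ^ ((3 + ⌈2 * a⌉₊) * m) : ℕ) : ℝ) := by
    rw [Nat.cast_prod]
    calc _ ≤ ∏ j : Fin m, 8 * ((m : ℝ) / ((j : ℕ) + 1)) ^ a :=
          Finset.prod_le_prod (fun _ _ => by positivity) fun j _ => h1 j
      _ = 8 ^ m * (∏ j : Fin m, (m : ℝ) / ((j : ℕ) + 1)) ^ a := by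
          rw [Finset.prod_mul_distrib, Finset.prod_const, Finset.card_univ, Fintype.card_fin,
            Real.finsetProd_rpow _ _ fun _ _ => by positivity]
      _ ≤ 8 ^ m * (2 : ℝ) ^ (⌈2 * a⌉₊ * m) := by gcongr
      _ = _ := by
          rw [show (8 : ℝ) = 2 ^ 3 by norm_num, ← pow_mul, ← pow_add, ← add_mul]
          push_cast
          rfl
  exact_mod_cast h4

/-- With `2 ^ (K m)` balls, the image of the unit ball is covered by quantizing the first `m`
coordinates with step `C m ^ (-a)` and replacing the others by `0`. -/
lemma entropyNumber_diagonal_le_of_mul_lt {a C : ℝ} (ha : 1 / 2 < a) (hC : 0 < C) {d : ℕ → ℝ}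
    {D : lp (fun _ : ℕ => ℝ) ∞ →L[ℝ] lp (fun _ : ℕ => ℝ) 2} (hD : IsDiagonalOperator d D)
    (hd : ∀ j : ℕ, |d j| ≤ C * ((j : ℝ) + 1) ^ (-a)) {m n : ℕ} (hm : 1 ≤ m)
    (hmn : (3 + ⌈2 * a⌉₊) * m ≤ n - 1) :
    entropyNumber D n ≤ C * √(1 + 1 / (2 * a - 1)) * (m : ℝ) ^ (1 / 2 - a) := by
  have hm0 : (0 : ℝ) < m := by exact_mod_cast hm
  have hpos : 0 < 2 * a - 1 := by linarith
  set s : ℝ := C * (m : ℝ) ^ (-a) with hs_def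
  have hs : 0 < s := by positivity
  let M : Fin m → ℕ := fun j => ⌈((m : ℝ) / ((j : ℕ) + 1)) ^ a⌉₊
  let ι := (j : Fin m) → Finset.Icc (-(M j : ℤ)) (M j)
  -- the coordinates `k_j` are the numbers of the cells, of width `s`
  let c : ι → ℕ → ℝ := fun k j => if h : j < m then s * ((k ⟨j, h⟩ : ℤ) : ℝ) else 0
  have hc : ∀ k, Memℓp (c k) 2 := by
    intro k
    refine memℓp_two_of_sum_sq_le (C := ∑ j ∈ Finset.range m, |c k j| ^ 2) fun t => ?_
    calc _ ≤ ∑ j ∈ t ∪ Finset.range m, |c k j| ^ 2 :=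
          Finset.sum_le_sum_of_subset_of_nonneg Finset.subset_union_left fun _ _ _ => by positivity
      _ = _ := by
          refine (Finset.sum_subset Finset.subset_union_right fun j _ hj => ?_).symm
          simp [c, show ¬ j < m by simpa using hj]
  refine entropyNumber_le_of_cover D n (ι := ι) ?_ (by positivity) (fun k => ⟨c k, hc k⟩) ?_
  · rw [Fintype.card_pi]
    refine le_trans (le_of_eq ?_) ((prod_levels_le (by linarith : 0 ≤ a) m).trans
      (Nat.pow_le_pow_right two_pos hmn))
    refine Finset.prod_congr rfl fun j _ => ?_
    rw [Fintype.card_coe, Int.card_Icc]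
    change _ = 2 * M j + 1
    omega
  intro b hb
  have hDb : ∀ j, |D b j| ≤ C * ((j : ℝ) + 1) ^ (-a) := by
    intro j
    rw [hD b j, abs_mul]
    have hbj : |b j| ≤ 1 := (lp.norm_apply_le_norm (by simp) b j).trans hb
    calc _ ≤ |d j| * 1 := by gcongr
      _ ≤ _ := by rw [mul_one]; exact hd j
  have hk : ∀ j : Fin m, ⌊D b j / s⌋ ∈ Finset.Icc (-(M j : ℤ)) (M j) := by
    intro j
    have hle : |D b j / s| ≤ M j := by
      rw [abs_div, abs_of_pos hs, div_le_iff₀ hs]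
      have hx : ((m : ℝ) / ((j : ℕ) + 1)) ^ a * s = C * (((j : ℕ) : ℝ) + 1) ^ (-a) := by
        rw [hs_def, Real.div_rpow hm0.le (by positivity), Real.rpow_neg hm0.le,
          Real.rpow_neg (by positivity)]
        have := (Real.rpow_pos_of_pos hm0 a).ne'
        field_simp
      calc _ ≤ _ := hDb j
        _ = _ := hx.symm
        _ ≤ _ := by gcongr; exact Nat.le_ceil _
    rw [abs_le] at hle
    rw [Finset.mem_Icc]
    constructor
    · rw [Int.le_floor]; push_cast; exact hle.1
    · have := (Int.floor_le (D b j / s)).trans hle.2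
      rwa [← Int.cast_natCast, Int.cast_le] at this
  let k : ι := fun j => ⟨⌊D b j / s⌋, hk j⟩
  have hsub : ∀ j, (D b - ⟨c k, hc k⟩ : lp (fun _ : ℕ => ℝ) 2) j = D b j - c k j := fun j => rfl
  refine ⟨k, norm_lp_two_le (by positivity) fun t => ?_⟩
  simp only [hsub]
  refine sum_sq_le_of_abs_le (f := fun j => D b j - c k j) ha hm
    (fun j hj => ?_) (fun j hj => ?_) t
  · have h0 : D b j - c k j = s * Int.fract (D b j / s) := by
      simp only [c, k, hj, dite_true]
      rw [← Int.self_sub_floor, mul_sub, mul_div_cancel₀ _ hs.ne']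
    rw [h0, abs_mul, abs_of_pos hs, abs_of_nonneg (Int.fract_nonneg _)]
    exact mul_le_of_le_one_right hs.le (Int.fract_lt_one _).le
  · have h0 : D b j - c k j = D b j := by simp [c, not_lt.2 hj]
    rw [h0]
    exact hDb j

/-- The entropy numbers of a diagonal operator from `ℓ_∞` to `ℓ_2` with entries `O(j ^ (-a))`,
`a > 1 / 2`, are `O(n ^ (1 / 2 - a))`. -/
lemma exists_entropyNumber_diagonal_le {a C : ℝ} (ha : 1 / 2 < a) (hC : 0 < C) {d : ℕ → ℝ}
    {D : lp (fun _ : ℕ => ℝ) ∞ →L[ℝ] lp (fun _ : ℕ => ℝ) 2} (hD : IsDiagonalOperator d D)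
    (hd : ∀ j : ℕ, |d j| ≤ C * ((j : ℝ) + 1) ^ (-a)) :
    ∃ B : ℝ, ∀ᶠ n : ℕ in atTop, (n : ℝ) ^ (a - 1 / 2) * entropyNumber D n ≤ B := by
  set K := 3 + ⌈2 * a⌉₊ with hK
  have hK0 : 0 < K := by omega
  set B₀ := C * √(1 + 1 / (2 * a - 1))
  have hB₀ : 0 ≤ B₀ := by positivity
  -- `m = ⌊(n - 1) / K⌋` is the largest admissible choice, and `m ≥ n / (2 K)`
  refine ⟨B₀ * (2 * K : ℝ) ^ (a - 1 / 2), ?_⟩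
  filter_upwards [eventually_ge_atTop (K + 1)] with n hn
  set m := (n - 1) / K
  have hm : 1 ≤ m := (Nat.one_le_div_iff hK0).2 (by omega)
  have hmn : K * m ≤ n - 1 := Nat.mul_div_le _ _
  have hnm : n ≤ 2 * K * m := by
    have h1 : n - 1 < K * (m + 1) := by
      rw [mul_comm]; exact Nat.lt_mul_of_div_lt (Nat.lt_succ_self _) hK0
    have h2 := Nat.mul_le_mul_left K hm
    rw [mul_add] at h1
    rw [mul_assoc]
    omega
  have hm0 : (0 : ℝ) < m := by exact_mod_cast hm
  have hnm' : (n : ℝ) ≤ 2 * K * m := by exact_mod_cast hnm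
  calc (n : ℝ) ^ (a - 1 / 2) * entropyNumber D n
      ≤ (2 * K * m : ℝ) ^ (a - 1 / 2) * (B₀ * (m : ℝ) ^ (1 / 2 - a)) := by
        have h2 := entropyNumber_diagonal_le_of_mul_lt ha hC hD hd hm hmn
        have h3 : 0 ≤ a - 1 / 2 := by linarith
        exact mul_le_mul (Real.rpow_le_rpow (by positivity) hnm' h3) h2
          (entropyNumber_nonneg _ _) (by positivity)
    _ = B₀ * (2 * K : ℝ) ^ (a - 1 / 2) * ((m : ℝ) ^ (a - 1 / 2) * (m : ℝ) ^ (1 / 2 - a)) := by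
        rw [Real.mul_rpow (by positivity) hm0.le]; ring
    _ = _ := by rw [← Real.rpow_add hm0]; simp

lemma exists_isDiagonalOperator {a C : ℝ} (ha : 1 / 2 < a) (hC : 0 < C) {d : ℕ → ℝ}
    (hd : ∀ j : ℕ, |d j| ≤ C * ((j : ℝ) + 1) ^ (-a)) :
    ∃ D : lp (fun _ : ℕ => ℝ) ∞ →L[ℝ] lp (fun _ : ℕ => ℝ) 2, IsDiagonalOperator d D := by
  set B := C * √(1 + 1 / (2 * a - 1))
  have hsum : ∀ (y : lp (fun _ : ℕ => ℝ) ∞) (s : Finset ℕ),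
      ∑ j ∈ s, |d j * y j| ^ 2 ≤ (B * ‖y‖) ^ 2 := by
    intro y s
    have hle : ∀ j, |d j * y j| ≤ C * ‖y‖ * ((j : ℝ) + 1) ^ (-a) := by
      intro j
      rw [abs_mul]
      have hy : |y j| ≤ ‖y‖ := lp.norm_apply_le_norm (by simp) y j
      calc _ ≤ C * ((j : ℝ) + 1) ^ (-a) * ‖y‖ := by gcongr; exact hd j
        _ = _ := by ring
    refine (sum_sq_le_of_abs_le (m := 1) ha le_rfl (fun j hj => ?_)
      (fun j _ => hle j) s).trans (le_of_eq ?_)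
    · obtain rfl : j = 0 := by omega
      simpa using hle 0
    · simp only [Nat.cast_one, Real.one_rpow, B]; ring
  refine ⟨LinearMap.mkContinuous
    { toFun := fun y => ⟨fun j => d j * y j, memℓp_two_of_sum_sq_le (hsum y)⟩
      map_add' := fun x y => by
        ext j
        change d j * (x j + y j) = d j * x j + d j * y j
        ring
      map_smul' := fun r y => by
        ext j
        change d j * (r * y j) = r * (d j * y j)
        ring } B fun y => norm_lp_two_le (by positivity) (hsum y), fun y j => rfl⟩

/-! ### The sampling operator -/

/-- A set with a compact inner regular measure that is a union of open null sets, over an arbitrary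
index set, is a null set. -/
lemma measure_iUnion_null_of_isOpen {X ι : Type*} [TopologicalSpace X] [MeasurableSpace X]
    [OpensMeasurableSpace X] (μ : Measure X) [μ.InnerRegular] {U : ι → Set X}
    (hU : ∀ i, IsOpen (U i)) (h0 : ∀ i, μ (U i) = 0) : μ (⋃ i, U i) = 0 := by
  rw [(isOpen_iUnion hU).measurableSet.measure_eq_iSup_isCompact]
  simp only [ENNReal.iSup_eq_zero]
  intro K hK hKc
  refine hKc.measure_zero_of_nhdsWithin fun x hx => ?_
  obtain ⟨i, hi⟩ := Set.mem_iUnion.1 (hK hx)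
  exact ⟨U i, mem_nhdsWithin_of_mem_nhds ((hU i).mem_nhds hi), h0 i⟩

/-- The exceptional null set in `|⟨z, φ(s)⟩| ≤ ‖u_∞ z‖` can be chosen independently of `z`, although
`E` need not be separable, as the law of `φ` is a Radon measure. -/
lemma ae_forall_abs_le_norm {E S : Type*} [NormedAddCommGroup E] [NormedSpace ℝ E]
    [MeasurableSpace S] (σ : Measure S) (φ : S → WeakDual ℝ E) (hφ : Measurable φ)
    (hφR : (σ.map φ).InnerRegular) (T : E → Lp ℝ ∞ σ)
    (hT : ∀ z, T z =ᵐ[σ] fun s => φ s z) :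
    ∃ p : S → Prop, Measurable p ∧ (∀ᵐ s ∂σ, p s) ∧ ∀ s, p s → ∀ z, |φ s z| ≤ ‖T z‖ := by
  have hopen : ∀ z : E, IsOpen {x : WeakDual ℝ E | ‖T z‖ < |x z|} := fun z =>
    isOpen_lt continuous_const (WeakDual.eval_continuous z).abs
  have hnull : ∀ z : E, σ.map φ {x : WeakDual ℝ E | ‖T z‖ < |x z|} = 0 := by
    intro z
    rw [Measure.map_apply hφ (hopen z).measurableSet, measure_eq_zero_iff_ae_notMem]
    filter_upwards [hT z, ae_le_eLpNormEssSup (f := T z) (μ := σ)] with s h1 h2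
    rw [← eLpNorm_exponent_top, ← Lp.enorm_def, enorm_le_iff_norm_le, h1, Real.norm_eq_abs] at h2
    simpa using h2
  have hU := measure_iUnion_null_of_isOpen (σ.map φ) hopen hnull
  have hm := (isOpen_iUnion hopen).measurableSet
  rw [Measure.map_apply hφ hm, measure_eq_zero_iff_ae_notMem] at hU
  refine ⟨_, measurableSet_setOfPred.1 (hφ hm).compl, hU, fun s hs z => ?_⟩
  have h : φ s ∉ ⋃ z, {x : WeakDual ℝ E | ‖T z‖ < |x z|} := hs
  simp only [Set.mem_iUnion, Set.mem_ofPred_eq, not_exists, not_lt] at h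
  exact h z

lemma exists_isSamplingOperator {E S : Type*} [NormedAddCommGroup E] [NormedSpace ℝ E]
    (φ : S → WeakDual ℝ E) (hφ1 : ∀ s, ‖WeakDual.toStrongDual (φ s)‖ ≤ 1) (s : ℕ → S) :
    ∃ w : E →L[ℝ] lp (fun _ : ℕ => ℝ) ∞, IsSamplingOperator φ s w := by
  have hle : ∀ (z : E) (j : ℕ), ‖φ (s j) z‖ ≤ 1 * ‖z‖ := fun z j =>
    (WeakDual.toStrongDual (φ (s j))).le_of_opNorm_le (hφ1 _) z
  refine ⟨LinearMap.mkContinuous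
    { toFun := fun z => ⟨fun j => φ (s j) z, memℓp_infty ⟨1 * ‖z‖, by
        rintro _ ⟨j, rfl⟩
        exact hle z j⟩⟩
      map_add' := fun x y => by
        ext j
        exact map_add (φ (s j)) x y
      map_smul' := fun r y => by
        ext j
        exact map_smul (φ (s j)) r y } 1 fun z => ?_, fun z j => rfl⟩
  exact lp.norm_le_of_forall_le (by positivity) (hle z)

/-! ### Arrival times -/

/-- By the strong law of large numbers, applied to the indicators of the events `ζ_i > 1`, the
arrival times grow at least linearly. -/
lemma ae_eventually_mul_le_arrival {Δ : Type*} [MeasurableSpace Δ] (Q : Measure Δ)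
    [IsProbabilityMeasure Q] (ζ : ℕ → Δ → ℝ) (hζ : ∀ j, HasLaw (ζ j) (expMeasure 1) Q)
    (hζi : iIndepFun ζ Q) :
    ∃ c : ℝ, 0 < c ∧ ∀ᵐ δ ∂Q, ∀ᶠ j : ℕ in atTop, c * ((j : ℝ) + 1) ≤ arrival ζ j δ := by
  have : IsProbabilityMeasure (expMeasure 1) := isProbabilityMeasure_expMeasure one_pos
  let g : ℝ → ℝ := (Set.Ioi 1).indicator 1
  have hg : Measurable g := measurable_one.indicator measurableSet_Ioi
  have hgb : ∀ x, ‖g x‖ ≤ 1 := fun x => by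
    by_cases hx : x ∈ Set.Ioi (1 : ℝ) <;> simp [g, hx]
  have hmean : ∫ δ, g (ζ 0 δ) ∂Q = Real.exp (-1) := by
    have h1 : ∫ x, g x ∂(expMeasure 1) = (expMeasure 1).real (Set.Ioi 1) :=
      integral_indicator_one measurableSet_Ioi
    have h2 : (expMeasure 1).real (Set.Iic 1) = 1 - Real.exp (-1) := by
      rw [← cdf_eq_real, cdf_expMeasure_eq one_pos]; simp
    have h3 := probReal_add_probReal_compl (μ := expMeasure 1) (measurableSet_Iic (a := (1 : ℝ)))
    rw [Set.compl_Iic] at h3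
    have h4 := (hζ 0).integral_comp (f := g) hg.aestronglyMeasurable
    rw [Function.comp_def] at h4
    linarith
  have hpos : ∀ᵐ δ ∂Q, ∀ j, 0 ≤ ζ j δ := by
    refine ae_all_iff.2 fun j => ?_
    rw [(hζ j).ae_iff (p := fun x => 0 ≤ x) (measurableSet_setOfPred.1 measurableSet_Ici)]
    have h2 : (expMeasure 1).real (Set.Iic 0) = 0 := by
      rw [← cdf_eq_real, cdf_expMeasure_eq one_pos]; simp
    rw [measureReal_eq_zero_iff] at h2
    filter_upwards [measure_eq_zero_iff_ae_notMem.1 h2] with x hx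
    exact (not_le.1 hx).le
  have hlaw := strong_law_ae_real (μ := Q) (fun i => g ∘ ζ i)
    ((integrable_const (1 : ℝ)).mono'
      (hg.comp_aemeasurable (hζ 0).aemeasurable).aestronglyMeasurable (ae_of_all _ fun δ => hgb _))
    (fun i j hij => (hζi.indepFun hij).comp hg hg)
    (fun i => ((hζ i).identDistrib (hζ 0)).comp hg)
  refine ⟨Real.exp (-1) / 2, by positivity, ?_⟩
  filter_upwards [hpos, hlaw] with δ h0 hl
  have hlt : Real.exp (-1) / 2 < ∫ δ, (g ∘ ζ 0) δ ∂Q := by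
    rw [Function.comp_def, hmean]
    exact half_lt_self (Real.exp_pos _)
  have hl' := (tendsto_add_atTop_iff_nat 1).2 hl
  filter_upwards [hl'.eventually (eventually_gt_nhds hlt)] with j hj
  rw [lt_div_iff₀ (by positivity)] at hj
  push_cast at hj
  refine hj.le.trans (Finset.sum_le_sum fun i _ => ?_)
  by_cases hx : 1 < ζ i δ
  · simpa [g, hx] using hx.le
  · simpa [g, hx] using h0 i

/-- The bound holds from the start and not only eventually, as `C` can absorb finitely many
entries. -/
lemma exists_abs_mul_rpow_le {a c : ℝ} (ha : 0 ≤ a) (hc : 0 < c) (b : ℝ) {Γ : ℕ → ℝ}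
    (h : ∀ᶠ j : ℕ in atTop, c * ((j : ℝ) + 1) ≤ Γ j) :
    ∃ C > 0, ∀ j : ℕ, |b * Γ j ^ (-a)| ≤ C * ((j : ℝ) + 1) ^ (-a) := by
  have hO : (fun j => b * Γ j ^ (-a)) =O[atTop] fun j : ℕ => ((j : ℝ) + 1) ^ (-a) := by
    refine Asymptotics.IsBigO.of_bound (|b| * c ^ (-a)) ?_
    filter_upwards [h] with j hj
    have hj0 : 0 < c * ((j : ℝ) + 1) := by positivity
    have hΓ : 0 < Γ j := hj0.trans_le hj
    rw [Real.norm_eq_abs, abs_mul, Real.norm_of_nonneg (by positivity),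
      abs_of_nonneg (Real.rpow_nonneg hΓ.le _), mul_assoc,
      ← Real.mul_rpow hc.le (by positivity)]
    exact mul_le_mul_of_nonneg_left (Real.rpow_le_rpow_of_nonpos hj0 hj (by linarith))
      (abs_nonneg b)
  obtain ⟨C, hC, hb⟩ := Asymptotics.bound_of_isBigO_nat_atTop hO
  refine ⟨C, hC, fun j => ?_⟩
  have hj : 0 < ((j : ℝ) + 1) ^ (-a) := by positivity
  simpa [abs_of_pos hj] using hb hj.ne'

end StableEntropy

theorem theorem3p3
    {E : Type*} [NormedAddCommGroup E] [NormedSpace ℝ E] [CompleteSpace E]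
    {S : Type*} [MeasurableSpace S] (σ : Measure S) [IsFiniteMeasure σ]
    (α : ℝ) (hα0 : 0 < α) (hα2 : α < 2)
    -- the decomposing function, its normalization, and its law being a Radon measure
    (φ : S → WeakDual ℝ E) (hφ : Measurable φ)
    (hφ1 : ∀ s, ‖WeakDual.toStrongDual (φ s)‖ ≤ 1)
    (hφR : (σ.map φ).InnerRegular)
    -- the operator `u : E → L_α` decomposed by `φ`, and the same operator into `L_∞`
    (u : E →ₗ[ℝ] Lp ℝ (ENNReal.ofReal α) σ) (hu : ∀ z, u z =ᵐ[σ] fun s => φ s z)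
    (uInf : E →L[ℝ] Lp ℝ ∞ σ) (huInf : ∀ z, uInf z =ᵐ[σ] u z)
    -- the random points `V_j`, and the exponential variables `ζ_j`
    {Δ : Type*} [MeasurableSpace Δ] (Q : Measure Δ) [IsProbabilityMeasure Q]
    (V : ℕ → Δ → S) (hV : ∀ j, HasLaw (V j) ((σ Set.univ)⁻¹ • σ) Q) (hVi : iIndepFun V Q)
    (ζ : ℕ → Δ → ℝ) (hζ : ∀ j, HasLaw (ζ j) (expMeasure 1) Q) (hζi : iIndepFun ζ Q)
    (hVζ : IndepFun (fun δ j => V j δ) (fun δ j => ζ j δ) Q) :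
    ∀ᵐ δ ∂Q, ∃ (w : E →L[ℝ] lp (fun _ : ℕ => ℝ) ∞)
      (D : lp (fun _ : ℕ => ℝ) ∞ →L[ℝ] lp (fun _ : ℕ => ℝ) 2),
      StableEntropy.IsSamplingOperator φ (fun j => V j δ) w ∧
      StableEntropy.IsDiagonalOperator
        (fun j => StableEntropy.stableConst α * σ.real Set.univ ^ (1 / α) *
          StableEntropy.arrival ζ j δ ^ (-1 / α)) D ∧
      limsup (fun n : ℕ =>
        ENNReal.ofReal ((n : ℝ) ^ (1 / α - 1 / 2) *
            StableEntropy.entropyNumber (D ∘L w) (2 * n - 1)) /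
          ENNReal.ofReal (StableEntropy.entropyNumber uInf n)) atTop < ⊤ := by
  have hα : 1 / 2 < 1 / α := one_div_lt_one_div_of_lt hα0 hα2
  obtain ⟨p, hp, hpσ, hpφ⟩ := StableEntropy.ae_forall_abs_le_norm σ φ hφ hφR uInf
    fun z => (huInf z).trans (hu z)
  have hpV : ∀ᵐ δ ∂Q, ∀ j, p (V j δ) := ae_all_iff.2 fun j =>
    ((hV j).ae_iff hp).2 (Measure.ae_smul_measure hpσ _)
  obtain ⟨c, hc, hΓ⟩ := StableEntropy.ae_eventually_mul_le_arrival Q ζ hζ hζi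
  filter_upwards [hpV, hΓ] with δ hpδ hΓδ
  obtain ⟨C, hC, hd⟩ := StableEntropy.exists_abs_mul_rpow_le (by positivity : 0 ≤ 1 / α) hc
    (StableEntropy.stableConst α * σ.real Set.univ ^ (1 / α)) hΓδ
  obtain ⟨w, hw⟩ := StableEntropy.exists_isSamplingOperator φ hφ1 fun j => V j δ
  obtain ⟨D, hD⟩ := StableEntropy.exists_isDiagonalOperator hα hC hd
  obtain ⟨B, hB⟩ := StableEntropy.exists_entropyNumber_diagonal_le hα hC hD hd
  have hwT : ∀ z, ‖w z‖ ≤ ‖uInf z‖ := fun z => lp.norm_le_of_forall_le (norm_nonneg _) fun j => by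
    rw [hw z j]
    exact hpφ _ (hpδ j) z
  refine ⟨w, D, hw, by simpa only [neg_div] using hD,
    lt_of_le_of_lt ?_ (ENNReal.ofReal_lt_top (r := 2 * B))⟩
  refine limsup_le_of_le (by isBoundedDefault) ?_
  filter_upwards [hB, eventually_ge_atTop 1] with n hn hn1
  refine ENNReal.div_le_of_le_mul ?_
  have hT := StableEntropy.entropyNumber_nonneg uInf n
  rw [← ENNReal.ofReal_mul' hT]
  refine ENNReal.ofReal_le_ofReal ?_
  calc _ ≤ (n : ℝ) ^ (1 / α - 1 / 2) *
        (2 * StableEntropy.entropyNumber D n * StableEntropy.entropyNumber uInf n) := by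
        gcongr
        exact StableEntropy.entropyNumber_comp_le_of_norm_le uInf w D hwT hn1
    _ = 2 * ((n : ℝ) ^ (1 / α - 1 / 2) * StableEntropy.entropyNumber D n) *
        StableEntropy.entropyNumber uInf n := by ring
    _ ≤ _ := by gcongr
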